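/- Let $d\ge 1$, let $\Omega\subset\mathbb{R}^d$ be a bounded domain (a nonempty bounded connected open set), and let $\lambda_1\le\lambda_2\le\cdots$ be the eigenvalues, repeated according to multiplicity, of the Dirichlet Laplacian on $\Omega$, with a corresponding orthonormal basis $(\varphi_n)_{n\ge1}$ of $L^2(\Omega)$ consisting of eigenfunctions; that is, $0\neq\varphi_n\in H^1_0(\Omega)$ and $\int_\Omega\nabla\varphi_n\cdot\nabla v\,dx=\lambda_n\int_\Omega\varphi_n v\,dx$ for all $v\in H^1_0(\Omega)$. Let $\tau>0$, let $\psi:[0,\tau]\to\mathbb{R}$ be continuous, and put $$\mu_n:=\int_0^\tau e^{-\lambda_n(\tau-s)}(\tau-s)\psi(s)\,ds,\qquad n\ge 1.$$ Assume that there are $\tau_0\in[0,\tau)$ and $\kappa_1>0$ such that $|\psi|\ge\kappa_1$ on $[\tau_0,\tau]$ and that one of the following holds: (i) $\psi$ does not change sign on $[0,\tau]$ (that is, $\psi\ge0$ on $[0,\tau]$ or $\psi\le0$ on $[0,\tau]$); (ii) $\psi$ changes sign on $[0,\tau]$ (so that $\tau_0>0$), $\psi$ is differentiable on $[0,\tau]$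 (one-sidedly at the endpoints), there is $\kappa_2>0$ with $|\psi'|\le\kappa_2$ on $[0,\tau]$, and $$|\psi(t)|\le\frac{(\tau-\tau_0)^2\kappa_1}{4\tau\tau_0}\quad\text{for all } t\in[0,\tau]\text{ with }\psi(t)\psi(\tau)\le 0 .$$ Then all $\lambda_n$ are positive and there is a constant $C>0$ such that $$|\mu_n|\ge\frac{C}{\lambda_n^2}\qquad\text{for all } n\ge 1 .$$ In particular, $\mu_n\ne0$ for all $n\ge1$. -/

import Mathlib

noncomputable section

namespace BiParabolic

/-- `ℝ^d` with its Euclidean norm. -/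
abbrev Space (d : ℕ) : Type := EuclideanSpace ℝ (Fin d)

/-- Lebesgue measure restricted to the open set `Ω`. -/
abbrev vol {d : ℕ} (Ω : TopologicalSpace.Opens (Space d)) : MeasureTheory.Measure (Space d) :=
  MeasureTheory.volume.restrict (Ω : Set (Space d))

/-- `L²(Ω)`, real-valued. -/
abbrev L2 {d : ℕ} (Ω : TopologicalSpace.Opens (Space d)) : Type :=
  MeasureTheory.Lp ℝ 2 (vol Ω)

/-- `L²(Ω; ℝ^d)`, square-integrable vector fields. -/
abbrev L2Vec {d : ℕ} (Ω : TopologicalSpace.Opens (Space d)) : Type :=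
  MeasureTheory.Lp (Space d) 2 (vol Ω)

/-- `G` is the weak gradient of `u` in `Ω`: `∫_Ω u ∂ᵢv = -∫_Ω Gᵢ v` for every coordinate `i` and
every `v ∈ C_c^∞(Ω)`. (The order of smoothness of a `TestFunction` is a `ℕ∞`, so `⊤` means
infinitely differentiable.) -/
def HasWeakGradient {d : ℕ} (Ω : TopologicalSpace.Opens (Space d)) (u : L2 Ω) (G : L2Vec Ω) :
    Prop :=
  ∀ (v : TestFunction Ω ℝ ⊤) (i : Fin d),
    ∫ x in (Ω : Set (Space d)), u x * (gradient (fun y => v y) x) i =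
      -∫ x in (Ω : Set (Space d)), (G x) i * v x

/-- `H¹(Ω)`, as the set of pairs `(u, ∇u)` with `u` and its weak gradient in `L²`. -/
def H1 {d : ℕ} (Ω : TopologicalSpace.Opens (Space d)) : Set (L2 Ω × L2Vec Ω) :=
  {p | HasWeakGradient Ω p.1 p.2}

/-- The pairs `(v, ∇v)` with `v ∈ C_c^∞(Ω)`. -/
def testPairs {d : ℕ} (Ω : TopologicalSpace.Opens (Space d)) : Set (L2 Ω × L2Vec Ω) :=
  {p | ∃ v : TestFunction Ω ℝ ⊤,
    (∀ᵐ x ∂(vol Ω), p.1 x = v x) ∧ ∀ᵐ x ∂(vol Ω), p.2 x = gradient (fun y => v y) x}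

/-- `H¹₀(Ω)`, as a set of pairs `(u, ∇u)`: the closure of `C_c^∞(Ω)` in `H¹(Ω)`. -/
def H10 {d : ℕ} (Ω : TopologicalSpace.Opens (Space d)) : Set (L2 Ω × L2Vec Ω) :=
  H1 Ω ∩ closure (testPairs Ω)

/-- `u` is a (weak) eigenfunction of the Dirichlet Laplacian on `Ω` with eigenvalue `lam`:
`0 ≠ u ∈ H¹₀(Ω)` and `∫_Ω ∇u · ∇v = lam ∫_Ω u v` for every `v ∈ H¹₀(Ω)`. -/
def IsDirichletEigenpair {d : ℕ} (Ω : TopologicalSpace.Opens (Space d)) (lam : ℝ) (u : L2 Ω) :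
    Prop :=
  u ≠ 0 ∧ ∃ G : L2Vec Ω, (u, G) ∈ H10 Ω ∧
    ∀ (v : L2 Ω) (H : L2Vec Ω), (v, H) ∈ H10 Ω →
      ∫ x in (Ω : Set (Space d)), inner ℝ (G x) (H x) =
        lam * ∫ x in (Ω : Set (Space d)), u x * v x

/-- `lam 0 ≤ lam 1 ≤ …` is the sequence of all eigenvalues of the Dirichlet Laplacian on `Ω`,
repeated according to multiplicity, and `φ 0, φ 1, …` is a corresponding orthonormal basis of
`L²(Ω)` of eigenfunctions. -/
structure IsDirichletEigensystem {d : ℕ} (Ω : TopologicalSpace.Opens (Space d)) (lam : ℕ → ℝ)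
    (φ : HilbertBasis ℕ ℝ (L2 Ω)) : Prop where
  mono : Monotone lam
  eigen : ∀ n, IsDirichletEigenpair Ω (lam n) (φ n)

/-- `ψ` does not change sign on `[0, τ]`. -/
def NoSignChange (τ : ℝ) (ψ : ℝ → ℝ) : Prop :=
  (∀ t ∈ Set.Icc 0 τ, 0 ≤ ψ t) ∨ (∀ t ∈ Set.Icc 0 τ, ψ t ≤ 0)

/-- The assumption on the temporal factor `ψ`. If `ψ` is continuous and changes sign then `τ₀ ≠ 0`,
so the division by `4 τ τ₀` is a genuine one. -/
def SourceAssumption (τ : ℝ) (ψ : ℝ → ℝ) : Prop :=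
  ∃ τ₀ ∈ Set.Ico 0 τ, ∃ κ₁ > 0,
    (∀ t ∈ Set.Icc τ₀ τ, κ₁ ≤ |ψ t|) ∧
    (NoSignChange τ ψ ∨
      (¬ NoSignChange τ ψ ∧
        DifferentiableOn ℝ ψ (Set.Icc 0 τ) ∧
        (∃ κ₂ > 0, ∀ t ∈ Set.Icc 0 τ, |derivWithin ψ (Set.Icc 0 τ) t| ≤ κ₂) ∧
        ∀ t ∈ Set.Icc 0 τ, ψ t * ψ τ ≤ 0 → |ψ t| ≤ (τ - τ₀) ^ 2 * κ₁ / (4 * τ * τ₀)))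

/-- `μ = ∫₀^τ e^{-lam (τ - s)} (τ - s) ψ(s) ds`. -/
def sourceCoeff (τ : ℝ) (ψ : ℝ → ℝ) (lam : ℝ) : ℝ :=
  ∫ s in (0 : ℝ)..τ, Real.exp (-lam * (τ - s)) * (τ - s) * ψ s

end BiParabolic

end

open MeasureTheory Set

namespace BiParabolic

/-! Replacing `ψ` by `-ψ`, assume `ψ τ ≥ 0`; then `ψ ≥ κ₁` on `[τ₀, τ]`. The kernel weights `[0,
τ₀]` by at most `e^{-lam (τ - τ₀)} τ`, while its mass on `[τ₀, τ]` is at least `e^{-lam (τ - τ₀)} (τ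
- τ₀)² / 2`. The threshold in the assumption is exactly what lets negative values of `ψ` cancel at
most half of the positive contribution (`le_sourceCoeff`). What survives is of order `lam⁻²`: on a
window of length proportional to `1 / lam` ending at `τ` the exponential stays bounded below.
Uniformity in `n` needs only a positive lower bound on the spectrum, here the first eigenvalue,
which Poincaré's inequality makes positive. -/

/-- A lower bound for the mass of the kernel `e^{-lam (τ - s)} (τ - s)` near `s = τ`. -/
theorem le_integral_kernel {lam τ τ₀ a : ℝ} (hlam : 0 ≤ lam) (ha : 0 ≤ a) (haτ : a ≤ τ - τ₀) :
    Real.exp (-lam * a) * (a ^ 2 / 2) ≤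
      ∫ s in τ₀..τ, Real.exp (-lam * (τ - s)) * (τ - s) := by
  have hi : ∀ b c : ℝ, IntervalIntegrable
      (fun s => Real.exp (-lam * (τ - s)) * (τ - s)) volume b c := fun b c =>
    Continuous.intervalIntegrable (by fun_prop) b c
  have h1 : ∫ s in (τ - a)..τ, Real.exp (-lam * a) * (τ - s) =
      Real.exp (-lam * a) * (a ^ 2 / 2) := by
    rw [intervalIntegral.integral_const_mul, intervalIntegral.integral_comp_sub_left (fun x => x)]
    simp
  rw [← h1, ← intervalIntegral.integral_add_adjacent_intervals (hi τ₀ (τ - a)) (hi (τ - a) τ)]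
  have h2 : 0 ≤ ∫ s in τ₀..(τ - a), Real.exp (-lam * (τ - s)) * (τ - s) := by
    refine intervalIntegral.integral_nonneg (by linarith) fun s hs => ?_
    exact mul_nonneg (Real.exp_pos _).le (by linarith [hs.2])
  have h3 : ∫ s in (τ - a)..τ, Real.exp (-lam * a) * (τ - s) ≤
      ∫ s in (τ - a)..τ, Real.exp (-lam * (τ - s)) * (τ - s) := by
    refine intervalIntegral.integral_mono_on (by linarith)
      (Continuous.intervalIntegrable (by fun_prop) _ _) (hi _ _) fun s hs => ?_
    refine mul_le_mul_of_nonneg_right (Real.exp_le_exp.2 ?_) (by linarith [hs.2])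
    nlinarith [mul_le_mul_of_nonneg_left (show τ - s ≤ a by linarith [hs.1]) hlam]
  linarith

/-- If the negative part of `ψ` on `[0, τ₀]` is small compared to the lower bound of `ψ` on
`[τ₀, τ]`, then the source coefficient is controlled from below by the kernel on `[τ₀, τ]`. -/
theorem le_sourceCoeff {lam τ τ₀ κ M : ℝ} {ψ : ℝ → ℝ} (hlam : 0 ≤ lam)
    (hψ : ContinuousOn ψ (Icc 0 τ)) (h0 : 0 ≤ τ₀) (h1 : τ₀ < τ) (hκ : 0 < κ) (hM : 0 ≤ M)
    (hMle : M * (τ * τ₀) ≤ (τ - τ₀) ^ 2 * κ / 4)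
    (hneg : ∀ t ∈ Icc 0 τ₀, -M ≤ ψ t) (hpos : ∀ t ∈ Icc τ₀ τ, κ ≤ ψ t) :
    κ / 2 * ∫ s in τ₀..τ, Real.exp (-lam * (τ - s)) * (τ - s) ≤ sourceCoeff τ ψ lam := by
  have hk : Continuous fun s => Real.exp (-lam * (τ - s)) * (τ - s) := by fun_prop
  have hc : ContinuousOn (fun s => Real.exp (-lam * (τ - s)) * (τ - s) * ψ s) (Icc 0 τ) :=
    hk.continuousOn.mul hψ
  have hi1 : IntervalIntegrable (fun s => Real.exp (-lam * (τ - s)) * (τ - s) * ψ s)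
      volume 0 τ₀ :=
    (hc.mono (Icc_subset_Icc_right h1.le)).intervalIntegrable_of_Icc h0
  have hi2 : IntervalIntegrable (fun s => Real.exp (-lam * (τ - s)) * (τ - s) * ψ s)
      volume τ₀ τ :=
    (hc.mono (Icc_subset_Icc_left h0)).intervalIntegrable_of_Icc h1.le
  rw [sourceCoeff, ← intervalIntegral.integral_add_adjacent_intervals hi1 hi2]
  have h2 : (∫ s in τ₀..τ, Real.exp (-lam * (τ - s)) * (τ - s)) * κ ≤
      ∫ s in τ₀..τ, Real.exp (-lam * (τ - s)) * (τ - s) * ψ s := by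
    rw [← intervalIntegral.integral_mul_const]
    refine intervalIntegral.integral_mono_on h1.le ((hk.intervalIntegrable _ _).mul_const _) hi2
      fun s hs => ?_
    exact mul_le_mul_of_nonneg_left (hpos s hs)
      (mul_nonneg (Real.exp_pos _).le (by linarith [hs.2]))
  have h3 : -(Real.exp (-lam * (τ - τ₀)) * (M * (τ * τ₀))) ≤
      ∫ s in (0 : ℝ)..τ₀, Real.exp (-lam * (τ - s)) * (τ - s) * ψ s := by
    have : ∫ _ in (0 : ℝ)..τ₀, Real.exp (-lam * (τ - τ₀)) * τ * (-M) =
        -(Real.exp (-lam * (τ - τ₀)) * (M * (τ * τ₀))) := by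
      rw [intervalIntegral.integral_const, smul_eq_mul]; ring
    rw [← this]
    refine intervalIntegral.integral_mono_on h0 intervalIntegrable_const hi1 fun s hs => ?_
    have hk0 : 0 ≤ Real.exp (-lam * (τ - s)) * (τ - s) :=
      mul_nonneg (Real.exp_pos _).le (by linarith [hs.2])
    have hk1 : Real.exp (-lam * (τ - s)) * (τ - s) ≤ Real.exp (-lam * (τ - τ₀)) * τ := by
      refine mul_le_mul (Real.exp_le_exp.2 ?_) (by linarith [hs.1]) (by linarith [hs.2])
        (Real.exp_pos _).le
      nlinarith [mul_le_mul_of_nonneg_left hs.2 hlam]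
    calc _ ≤ Real.exp (-lam * (τ - s)) * (τ - s) * (-M) :=
          mul_le_mul_of_nonpos_right hk1 (by linarith)
      _ ≤ _ := mul_le_mul_of_nonneg_left (hneg s hs) hk0
  -- The full window `a = τ - τ₀` carries the same factor `e^{-lam (τ - τ₀)}` as the loss `h3`, so
  -- `hMle` charges that loss to half of the gain `h2`.
  have h4 := le_integral_kernel hlam (sub_nonneg.2 h1.le) (le_refl (τ - τ₀))
  have h5 := mul_le_mul_of_nonneg_left hMle (Real.exp_pos (-lam * (τ - τ₀))).le
  nlinarith [mul_le_mul_of_nonneg_right h4 hκ.le]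

theorem SourceAssumption.neg {τ : ℝ} {ψ : ℝ → ℝ} (h : SourceAssumption τ ψ) :
    SourceAssumption τ (fun t => -ψ t) := by
  obtain ⟨τ₀, hτ₀, κ₁, hκ₁, hlow, hsign⟩ := h
  have hiff : NoSignChange τ (fun t => -ψ t) ↔ NoSignChange τ ψ := by
    simp only [NoSignChange, neg_nonneg, neg_nonpos, or_comm]
  refine ⟨τ₀, hτ₀, κ₁, hκ₁, by simpa only [abs_neg] using hlow, ?_⟩
  rw [hiff]
  refine hsign.imp_right fun ⟨h1, h2, ⟨κ₂, hκ₂, h3⟩, h4⟩ => ⟨h1, h2.fun_neg, ⟨κ₂, hκ₂, ?_⟩, ?_⟩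
  · intro t ht
    rw [derivWithin.fun_neg, abs_neg]
    exact h3 t ht
  · simpa only [neg_mul_neg, abs_neg] using h4

theorem sourceCoeff_neg (τ : ℝ) (ψ : ℝ → ℝ) (lam : ℝ) :
    sourceCoeff τ (fun t => -ψ t) lam = -sourceCoeff τ ψ lam := by
  simp only [sourceCoeff, mul_neg, intervalIntegral.integral_neg]

theorem exists_le_sourceCoeff_of_pos {τ : ℝ} (hτ : 0 < τ) {ψ : ℝ → ℝ}
    (hψ : ContinuousOn ψ (Icc 0 τ)) (hA : SourceAssumption τ ψ) (hend : 0 ≤ ψ τ)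
    {lam₀ : ℝ} (hlam₀ : 0 < lam₀) :
    ∃ C > 0, ∀ lam, lam₀ ≤ lam → C / lam ^ 2 ≤ sourceCoeff τ ψ lam := by
  obtain ⟨τ₀, ⟨h0, h1⟩, κ, hκ, hlow, hsign⟩ := hA
  have hψτ : 0 < ψ τ := by
    have := hlow τ ⟨h1.le, le_rfl⟩
    rw [abs_of_nonneg hend] at this
    linarith
  have hpos : ∀ t ∈ Icc τ₀ τ, κ ≤ ψ t := by
    intro t ht
    rcases le_abs.1 (hlow t ht) with h | h
    · exact h
    -- A negative value at `t` would force a zero in `[t, τ]`, where `|ψ| ≥ κ`.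
    · obtain ⟨c, hc, hc0⟩ : (0 : ℝ) ∈ ψ '' Icc t τ :=
        intermediate_value_Icc ht.2 (hψ.mono (Icc_subset_Icc_left (h0.trans ht.1)))
          ⟨by linarith, hend⟩
      have := hlow c ⟨ht.1.trans hc.1, hc.2⟩
      rw [hc0, abs_zero] at this
      linarith
  obtain ⟨M, hM, hMle, hneg⟩ : ∃ M, 0 ≤ M ∧ M * (τ * τ₀) ≤ (τ - τ₀) ^ 2 * κ / 4 ∧
      ∀ t ∈ Icc 0 τ₀, -M ≤ ψ t := by
    rcases hsign with (h | h) | ⟨-, -, -, h⟩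
    · refine ⟨0, le_rfl, by rw [zero_mul]; positivity, fun t ht => ?_⟩
      simpa using h t ⟨ht.1, ht.2.trans h1.le⟩
    · exact absurd (h τ ⟨hτ.le, le_rfl⟩) (not_le.2 hψτ)
    · refine ⟨(τ - τ₀) ^ 2 * κ / (4 * τ * τ₀), by positivity, ?_, fun t ht => ?_⟩
      -- For `τ₀ = 0` the quotient is `0` by convention, and the bound is trivial.
      · rcases h0.eq_or_lt with rfl | h0
        · simp only [mul_zero]; positivity
        · apply le_of_eq; field_simp
      · rcases le_total 0 (ψ t) with hp | hp
        · exact le_trans (neg_nonpos.2 (by positivity)) hp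
        · exact neg_le_of_abs_le (h t ⟨ht.1, ht.2.trans h1.le⟩
            (mul_nonpos_of_nonpos_of_nonneg hp hψτ.le))
  have hδ : 0 < τ - τ₀ := sub_pos.2 h1
  -- The window `a = lam₀ (τ - τ₀) / lam` makes `lam * a` constant, and `lam₀ ≤ lam` keeps it inside
  -- `[τ₀, τ]`.
  refine ⟨κ / 2 * (Real.exp (-(lam₀ * (τ - τ₀))) * ((lam₀ * (τ - τ₀)) ^ 2 / 2)), by positivity,
    fun lam hlam => ?_⟩
  have hl : 0 < lam := hlam₀.trans_le hlam
  have hK := le_integral_kernel (τ := τ) (τ₀ := τ₀) (a := lam₀ * (τ - τ₀) / lam) hl.le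
    (by positivity) (by rw [div_le_iff₀ hl]; nlinarith)
  have hmul : -lam * (lam₀ * (τ - τ₀) / lam) = -(lam₀ * (τ - τ₀)) := by field_simp
  rw [hmul] at hK
  refine le_trans (le_of_eq ?_) ((mul_le_mul_of_nonneg_left hK (by positivity)).trans
    (le_sourceCoeff hl.le hψ h0 h1 hκ hM hMle hneg hpos))
  field_simp

theorem exists_le_abs_sourceCoeff {τ : ℝ} (hτ : 0 < τ) {ψ : ℝ → ℝ}
    (hψ : ContinuousOn ψ (Icc 0 τ)) (hA : SourceAssumption τ ψ) {lam₀ : ℝ} (hlam₀ : 0 < lam₀) :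
    ∃ C > 0, ∀ lam, lam₀ ≤ lam → C / lam ^ 2 ≤ |sourceCoeff τ ψ lam| := by
  rcases le_total 0 (ψ τ) with h | h
  · obtain ⟨C, hC, hle⟩ := exists_le_sourceCoeff_of_pos hτ hψ hA h hlam₀
    exact ⟨C, hC, fun lam hlam => (hle lam hlam).trans (le_abs_self _)⟩
  · obtain ⟨C, hC, hle⟩ :=
      exists_le_sourceCoeff_of_pos hτ hψ.fun_neg hA.neg (neg_nonneg.2 h) hlam₀
    refine ⟨C, hC, fun lam hlam => (hle lam hlam).trans ?_⟩
    rw [sourceCoeff_neg]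
    exact neg_le_abs _

/-! ### Positivity of the Dirichlet eigenvalues -/

/-- **Poincaré's inequality** for test functions on a set contained in a ball of radius `R`. -/
theorem integral_sq_testFunction_le {d : ℕ} (hd : 1 ≤ d) {Ω : TopologicalSpace.Opens (Space d)}
    {R : ℝ} (hR : ∀ x ∈ (Ω : Set (Space d)), ‖x‖ ≤ R) (v : TestFunction Ω ℝ ⊤) :
    ∫ x in (Ω : Set (Space d)), v x * v x ≤
      (2 * R) ^ 2 * ∫ x in (Ω : Set (Space d)),
        inner ℝ (gradient (fun y => v y) x) (gradient (fun y => v y) x) := by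
  let i : Fin d := ⟨0, hd⟩
  let e : Space d := EuclideanSpace.single i 1
  let l : Space d →L[ℝ] ℝ := EuclideanSpace.proj i
  have hle : l e = 1 := by simp [l, e]
  have hl : ∀ x, ‖l x‖ ≤ ‖x‖ := fun x => PiLp.norm_apply_le x i
  have hdiff : Differentiable ℝ v := v.contDiff.differentiable (by simp)
  have hdc : Continuous (fderiv ℝ v) := v.contDiff.continuous_fderiv (by simp)
  have hdv : Continuous fun x => fderiv ℝ v x e := hdc.clm_apply continuous_const
  have hcs : HasCompactSupport v := v.hasCompactSupport
  have hvc : Continuous v := v.continuous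
  have hgrad : ∀ x, inner ℝ (gradient (fun y => v y) x) (gradient (fun y => v y) x) =
      ‖fderiv ℝ v x‖ ^ 2 := fun x => by
    rw [real_inner_self_eq_norm_sq, gradient, LinearIsometryEquiv.norm_map]
  have hsq : ∀ x, fderiv ℝ (fun y => v y * v y) x e = 2 * (v x * fderiv ℝ v x e) := fun x => by
    rw [fderiv_fun_mul (hdiff x) (hdiff x)]
    simp; ring
  have hz : ∀ x, x ∉ (Ω : Set (Space d)) → v x = 0 := fun x hx =>
    image_eq_zero_of_notMem_tsupport fun h => hx (v.tsupport_subset h)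
  -- Since `∂ₑ l = 1`, this turns `∫ v²` into `-∫ l · 2 v ∂ₑv`, with `|l| ≤ R` on `Ω`.
  have hibp := integral_mul_fderiv_eq_neg_fderiv_mul_of_integrable (μ := volume) (𝕜 := ℝ)
    (f := fun x => l x) (g := fun x => v x * v x) (v := e)
    (by
      simp only [ContinuousLinearMap.fderiv, hle, one_mul]
      exact (hvc.mul hvc).integrable_of_hasCompactSupport hcs.mul_left)
    (by
      simp only [hsq]
      exact (by fun_prop : Continuous fun x => l x * (2 * (v x * fderiv ℝ v x e)))
        |>.integrable_of_hasCompactSupport hcs.mul_right.mul_left.mul_left)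
    ((by fun_prop : Continuous fun x => l x * (v x * v x)).integrable_of_hasCompactSupport
      hcs.mul_left.mul_left)
    (fun x _ => l.differentiableAt) (fun x _ => (hdiff x).mul (hdiff x))
  simp only [ContinuousLinearMap.fderiv, hle, one_mul, hsq] at hibp
  rw [← setIntegral_eq_integral_of_forall_compl_eq_zero (s := (Ω : Set (Space d)))
      (fun x hx => by simp [hz x hx]),
    ← setIntegral_eq_integral_of_forall_compl_eq_zero (s := (Ω : Set (Space d)))
      (f := fun x => v x * v x) (fun x hx => by simp [hz x hx])] at hibp
  have hi1 : IntegrableOn (fun x => v x * v x) (Ω : Set (Space d)) :=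
    ((hvc.mul hvc).integrable_of_hasCompactSupport hcs.mul_left).integrableOn
  have hi2 : IntegrableOn (fun x => ‖fderiv ℝ v x‖ ^ 2) (Ω : Set (Space d)) :=
    ((by fun_prop : Continuous fun x => ‖fderiv ℝ v x‖ ^ 2).integrable_of_hasCompactSupport
      ((hcs.fderiv ℝ).comp_left (g := fun z => ‖z‖ ^ 2) (by simp))).integrableOn
  have hi3 : IntegrableOn (fun x => l x * (2 * (v x * fderiv ℝ v x e))) (Ω : Set (Space d)) :=
    ((by fun_prop : Continuous fun x => l x * (2 * (v x * fderiv ℝ v x e)))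
      |>.integrable_of_hasCompactSupport hcs.mul_right.mul_left.mul_left).integrableOn
  have hmono : ∫ x in (Ω : Set (Space d)), -(l x * (2 * (v x * fderiv ℝ v x e))) ≤
      ∫ x in (Ω : Set (Space d)),
        (1 / 2 * (v x * v x) + 2 * R ^ 2 * ‖fderiv ℝ v x‖ ^ 2) := by
    have hi4 : IntegrableOn (fun x => -(l x * (2 * (v x * fderiv ℝ v x e))))
        (Ω : Set (Space d)) := Integrable.neg hi3
    have hi5 : IntegrableOn (fun x => 1 / 2 * (v x * v x) + 2 * R ^ 2 * ‖fderiv ℝ v x‖ ^ 2)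
        (Ω : Set (Space d)) :=
      Integrable.add (Integrable.const_mul hi1 (1 / 2)) (Integrable.const_mul hi2 (2 * R ^ 2))
    refine setIntegral_mono_on hi4 hi5 Ω.isOpen.measurableSet fun x hx => ?_
    have he : ‖fderiv ℝ v x e‖ ≤ ‖fderiv ℝ v x‖ := by
      simpa [e] using (fderiv ℝ v x).le_opNorm e
    have h1 : |l x * fderiv ℝ v x e| ≤ R * ‖fderiv ℝ v x‖ := by
      rw [abs_mul]
      exact mul_le_mul ((hl x).trans (hR x hx)) he (abs_nonneg _)
        ((norm_nonneg x).trans (hR x hx))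
    have h2 : (l x * fderiv ℝ v x e) ^ 2 ≤ (R * ‖fderiv ℝ v x‖) ^ 2 :=
      sq_le_sq' (neg_le_of_abs_le h1) (le_of_abs_le h1)
    -- Young's inequality, weighted so that only half of `v²` appears and can be absorbed on the
    -- left.
    nlinarith [sq_nonneg (v x + 2 * (l x * fderiv ℝ v x e))]
  rw [integral_neg, hibp, neg_neg, integral_add (hi1.const_mul _) (hi2.const_mul _),
    integral_const_mul, integral_const_mul] at hmono
  simp only [hgrad]
  linarith

/-- **Poincaré's inequality** on `H¹₀(Ω)` for `Ω` contained in a ball of radius `R`. -/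
theorem norm_fst_le_of_mem_H10 {d : ℕ} (hd : 1 ≤ d) {Ω : TopologicalSpace.Opens (Space d)}
    {R : ℝ} (hR0 : 0 ≤ R) (hR : ∀ x ∈ (Ω : Set (Space d)), ‖x‖ ≤ R) {p : L2 Ω × L2Vec Ω}
    (hp : p ∈ H10 Ω) : ‖p.1‖ ≤ 2 * R * ‖p.2‖ := by
  have hclosed : IsClosed {q : L2 Ω × L2Vec Ω | ‖q.1‖ ≤ 2 * R * ‖q.2‖} :=
    isClosed_le (by fun_prop) (by fun_prop)
  refine closure_minimal (fun q hq => ?_) hclosed hp.2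
  obtain ⟨v, h1, h2⟩ := hq
  refine (sq_le_sq₀ (norm_nonneg _) (by positivity)).1 ?_
  rw [mul_pow, ← real_inner_self_eq_norm_sq, ← real_inner_self_eq_norm_sq, L2.inner_def,
    L2.inner_def, integral_congr_ae (g := fun x => v x * v x)
      (h1.mono fun x hx => by simp [hx, pow_two]),
    integral_congr_ae (f := fun x => inner ℝ (q.2 x) (q.2 x)) (g := fun x => inner ℝ (gradient (fun y => v y) x)
      (gradient (fun y => v y) x)) (h2.mono fun x hx => by simp only [hx])]
  exact integral_sq_testFunction_le hd hR v

theorem IsDirichletEigenpair.pos {d : ℕ} (hd : 1 ≤ d) {Ω : TopologicalSpace.Opens (Space d)}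
    (hΩ : Bornology.IsBounded (Ω : Set (Space d))) {lam : ℝ} {u : L2 Ω}
    (h : IsDirichletEigenpair Ω lam u) : 0 < lam := by
  obtain ⟨hu, G, hG, hw⟩ := h
  obtain ⟨R, hR0, hR⟩ := hΩ.exists_pos_norm_le
  have hle : ‖u‖ ≤ 2 * R * ‖G‖ := norm_fst_le_of_mem_H10 (p := (u, G)) hd hR0.le hR hG
  have hupos : 0 < ‖u‖ := norm_pos_iff.2 hu
  have hGpos : 0 < ‖G‖ :=
    (mul_pos_iff_of_pos_left (by linarith : 0 < 2 * R)).1 (hupos.trans_le hle)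
  -- Test the weak equation with the eigenfunction itself.
  have heq : ‖G‖ ^ 2 = lam * ‖u‖ ^ 2 := by
    rw [← real_inner_self_eq_norm_sq, ← real_inner_self_eq_norm_sq, L2.inner_def, L2.inner_def]
    simpa [pow_two] using hw u G hG
  have hmul : 0 < lam * ‖u‖ ^ 2 := by rw [← heq]; exact pow_pos hGpos 2
  exact (mul_pos_iff_of_pos_right (pow_pos hupos 2)).1 hmul

end BiParabolic

theorem theorem3p1 (d : ℕ) (hd : 1 ≤ d) (Ω : TopologicalSpace.Opens (BiParabolic.Space d))
    (hΩconn : IsConnected (Ω : Set (BiParabolic.Space d)))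
    (hΩbdd : Bornology.IsBounded (Ω : Set (BiParabolic.Space d)))
    (lam : ℕ → ℝ) (φ : HilbertBasis ℕ ℝ (BiParabolic.L2 Ω))
    (hlam : BiParabolic.IsDirichletEigensystem Ω lam φ)
    (τ : ℝ) (hτ : 0 < τ) (ψ : ℝ → ℝ) (hψ : ContinuousOn ψ (Set.Icc 0 τ))
    (hA : BiParabolic.SourceAssumption τ ψ) :
    (∀ n : ℕ, 0 < lam n) ∧
      (∃ C > 0, ∀ n : ℕ, C / lam n ^ 2 ≤ |BiParabolic.sourceCoeff τ ψ (lam n)|) ∧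
      (∀ n : ℕ, BiParabolic.sourceCoeff τ ψ (lam n) ≠ 0) := by
  have hpos : ∀ n, 0 < lam n := fun n => (hlam.eigen n).pos hd hΩbdd
  obtain ⟨C, hC, hle⟩ := BiParabolic.exists_le_abs_sourceCoeff hτ hψ hA (hpos 0)
  have hbound : ∀ n, C / lam n ^ 2 ≤ |BiParabolic.sourceCoeff τ ψ (lam n)| := fun n =>
    hle (lam n) (hlam.mono (Nat.zero_le n))
  exact ⟨hpos, ⟨C, hC, hbound⟩, fun n =>
    abs_pos.1 ((div_pos hC (pow_pos (hpos n) 2)).trans_le (hbound n))⟩
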